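/- Let $\lambda$ be an infinite regular cardinal and let $\mathcal R$ be a small additive category which has $\lambda$-small products (products of families indexed by sets of cardinality $<\lambda$). Let $\mathcal M=\mathcal R\text{-}\mathrm{Mod}$ be the category of left $\mathcal R$-modules, i.e. of additive functors $\mathcal R\to\mathbf{Ab}$, and let $\mathcal N\subseteq\mathcal M$ be the full subcategory of those modules which preserve $\lambda$-small products. Write $\mathrm{fun}_\lambda\,\mathcal N$ for the class of functors $\mathcal N\to\mathbf{Ab}$ that preserve $\lambda$-directed colimits and all (small) products, and $\mathrm{fun}\,\mathcal M$ for the class of functors $\mathcal M\to\mathbf{Ab}$ that preserve directed colimits and all (small) products. For an object $n$ of $\mathcal R$, a pp-$n$-formula $\phi$ is a cospan $n\xrightarrow{A}m\xleftarrow{B}l$ in $\mathcal R$; for $M\in\mathcal M$ put $$F_\phi M=\{x\in M(n) : M(A)x=M(B)y\text{ for some }y\in M(l)\},$$ a subgroup of $M(n)$, functorial in $M$. A pp-pair $\phi/\psi$ consists of two pp-$n$-formulas (for the same object $n$) such that $F_\psi M\subseteq F_\phi M$ for all $M\in\mathcal M$, and $F_{\phi/\psi}=F_\phi/F_\psi:\mathcal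 M\to\mathbf{Ab}$. Then 1. $\mathrm{fun}_\lambda\,\mathcal N=\{F|_{\mathcal N} : F\in\mathrm{fun}\,\mathcal M\}$; that is, a functor $G:\mathcal N\to\mathbf{Ab}$ preserves $\lambda$-directed colimits and products if and only if it is the restriction to $\mathcal N$ of a functor $\mathcal M\to\mathbf{Ab}$ that preserves directed colimits and products. 2. A functor $G:\mathcal N\to\mathbf{Ab}$ belongs to $\mathrm{fun}_\lambda\,\mathcal N$ if and only if there is a pp-pair $\phi/\psi$ for left $\mathcal R$-modules with $G\simeq F_{\phi/\psi}|_{\mathcal N}$. -/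

import Mathlib

open CategoryTheory Limits

universe u

noncomputable section

namespace LambdaModules

/-- Left `R`-modules over a small preadditive category `R`: additive functors `R ⥤ Ab`. -/
abbrev LeftMod (R : Type u) [SmallCategory R] [Preadditive R] : Type (u + 1) :=
  R ⥤+ AddCommGrpCat.{u}

/-- `R` has `κ`-small products. -/
def HasSmallProducts (κ : Cardinal.{u}) (R : Type u) [SmallCategory R] : Prop :=
  ∀ J : Type u, Cardinal.mk J < κ → HasProductsOfShape J R

/-- The left `R`-modules that preserve `κ`-small products. -/
def preservesSmallProducts (κ : Cardinal.{u}) (R : Type u) [SmallCategory R] [Preadditive R] :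
    ObjectProperty (LeftMod R) :=
  fun M => ∀ J : Type u, Cardinal.mk J < κ → PreservesLimitsOfShape (Discrete J) M.obj

/-- The full subcategory of `LeftMod R` on the modules that preserve `κ`-small products. -/
abbrev ProdMod (κ : Cardinal.{u}) (R : Type u) [SmallCategory R] [Preadditive R] :
    Type (u + 1) :=
  (preservesSmallProducts κ R).FullSubcategory

/-- Restriction to `ProdMod κ R` of a functor on `LeftMod R`. -/
abbrev restrict (κ : Cardinal.{u}) {R : Type u} [SmallCategory R] [Preadditive R]
    (F : LeftMod R ⥤ AddCommGrpCat.{u}) : ProdMod κ R ⥤ AddCommGrpCat.{u} :=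
  (preservesSmallProducts κ R).ι ⋙ F

/-- The functors `C ⥤ Ab` that preserve `κ`-directed (equivalently, `κ`-filtered) colimits
and all (small) products. -/
def funCard (κ : Cardinal.{u}) [Fact κ.IsRegular] (C : Type (u + 1)) [Category.{u} C] :
    ObjectProperty (C ⥤ AddCommGrpCat.{u}) :=
  fun F => F.IsCardinalAccessible κ ∧ ∀ J : Type u, PreservesLimitsOfShape (Discrete J) F

/-- The functors `C ⥤ Ab` that preserve directed colimits and all (small) products:
the case `κ = ℵ₀`. -/
def funFin (C : Type (u + 1)) [Category.{u} C] : ObjectProperty (C ⥤ AddCommGrpCat.{u}) :=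
  haveI : Fact (Cardinal.aleph0.{u}).IsRegular := Cardinal.fact_isRegular_aleph0
  funCard Cardinal.aleph0.{u} C

/-- A pp-`n`-formula for left `R`-modules: a cospan `n ⟶ m ⟵ l` in `R`. -/
structure PPFormula (R : Type u) [SmallCategory R] (n : R) where
  m : R
  l : R
  A : n ⟶ m
  B : l ⟶ m

variable {R : Type u} [SmallCategory R] [Preadditive R]

/-- The solution set of `φ` in `M`: the `x` in `M n` such that `A x = B y` for some `y` in
`M l`. -/
def PPFormula.sol {n : R} (φ : PPFormula R n) (M : LeftMod R) : AddSubgroup (M.obj.obj n) where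
  carrier := {x | ∃ y : M.obj.obj φ.l, M.obj.map φ.A x = M.obj.map φ.B y}
  zero_mem' := ⟨0, by simp⟩
  add_mem' := by
    rintro a b ⟨y, hy⟩ ⟨z, hz⟩
    exact ⟨y + z, by simp [hy, hz]⟩
  neg_mem' := by
    rintro a ⟨y, hy⟩
    exact ⟨-y, by simp [hy]⟩

lemma PPFormula.sol_map {n : R} (φ : PPFormula R n) {M N : LeftMod R} (f : M ⟶ N)
    {x : M.obj.obj n} (hx : x ∈ φ.sol M) : f.hom.app n x ∈ φ.sol N := by
  obtain ⟨y, hy⟩ := hx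
  refine ⟨f.hom.app φ.l y, ?_⟩
  rw [← NatTrans.naturality_apply, ← NatTrans.naturality_apply, hy]

/-- The map on solution sets induced by a morphism of modules. -/
def PPFormula.solMap {n : R} (φ : PPFormula R n) {M N : LeftMod R} (f : M ⟶ N) :
    φ.sol M →+ φ.sol N :=
  ((f.hom.app n).hom.comp (φ.sol M).subtype).codRestrict (φ.sol N)
    (fun x => φ.sol_map f x.2)

/-- A pp-`n`-pair `φ/ψ`: two pp-`n`-formulas such that the solution set of `ψ` is contained in
that of `φ` in every left `R`-module. -/
structure PPPair (R : Type u) [SmallCategory R] [Preadditive R] (n : R) where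
  φ : PPFormula R n
  ψ : PPFormula R n
  le : ∀ M : LeftMod R, ψ.sol M ≤ φ.sol M

/-- The functor `F_{φ/ψ} = F_φ / F_ψ` on left `R`-modules. -/
def PPPair.functor {n : R} (p : PPPair R n) : LeftMod R ⥤ AddCommGrpCat.{u} where
  obj M := AddCommGrpCat.of (p.φ.sol M ⧸ (p.ψ.sol M).addSubgroupOf (p.φ.sol M))
  map {M N} f := AddCommGrpCat.ofHom
    (QuotientAddGroup.map ((p.ψ.sol M).addSubgroupOf (p.φ.sol M))
      ((p.ψ.sol N).addSubgroupOf (p.φ.sol N)) (p.φ.solMap f)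
      (fun _ hx => p.ψ.sol_map f hx))
  map_id M := by
    ext x
    rfl
  map_comp f g := by
    ext x
    rfl

end LambdaModules

end

noncomputable section

namespace LambdaModules

/-! Write `N` for the modules preserving `κ`-small products. Solution sets of pp-formulas commute
with filtered colimits and with products, and so do quotients in `Ab`; `N` is closed under products
and `κ`-filtered colimits, so restricted pp-pairs preserve both.

Conversely, let `P` be the cokernel of `R(m, -) ⟶ R(n, -)` induced by `A : n ⟶ m`. It lies in `N`,
and `Hom(P, X)` is the solution set of `A x = 0` in `X`. As `R` has `κ`-small products and `X` in
`N` preserves them, fewer than `κ` elements or relations merge into one; hence `X` is a `κ`-filtered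
colimit of such `P` (`nonempty_isColimit_cocone`).

If `G` preserves these colimits and products, every element of `G X` comes from some `P`. There is
only a set of pairs `(P, y)` with `y` in `G P`; the family of all these `y` is one element of `G` at
a product, which itself comes from one `P` (`exists_generator`). So `Hom(P, -) ⟶ G` is onto, and the
same argument for its kernel gives an exact sequence `Hom(Q, -) ⟶ Hom(P, -) ⟶ G ⟶ 0`. The image of
`Hom(Q, -)` is pp-definable, so `G` is a pp-pair on `N`. -/

/-! ### Products and filtered colimits of abelian groups, on elements -/

lemma injective_pi_of_forall_eq_zero {J : Type*} {A : Type*} {B : J → Type*} [AddGroup A]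
    [∀ j, AddGroup (B j)] (f : ∀ j, A →+ B j) (h : ∀ x, (∀ j, f j x = 0) → x = 0) :
    Function.Injective (fun x j => f j x) :=
  fun x y hxy => sub_eq_zero.1 (h _ fun j => by rw [map_sub, sub_eq_zero]; exact congrFun hxy j)

/-- A cone over a discrete diagram of abelian groups is a limit cone iff it identifies its point
with the group of all families. -/
lemma nonempty_isLimit_iff_bijective {J : Type u} {F : Discrete J ⥤ AddCommGrpCat.{u}}
    (c : Cone F) : Nonempty (IsLimit c) ↔
      Function.Bijective (fun (x : c.pt) (j : J) => (c.π.app ⟨j⟩ x : F.obj ⟨j⟩)) := by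
  have h : Nonempty (IsLimit c) ↔ Nonempty (IsLimit ((forget AddCommGrpCat.{u}).mapCone c)) :=
    ⟨fun ⟨h⟩ => ⟨isLimitOfPreserves _ h⟩, fun ⟨h⟩ => ⟨isLimitOfReflects _ h⟩⟩
  rw [h, Types.isLimit_iff, Function.bijective_iff_existsUnique]
  constructor
  · intro h y
    obtain ⟨x, hx, hx'⟩ := h (fun j => y j.as) (by
      rintro ⟨i⟩ ⟨j⟩ ⟨⟨rfl : i = j⟩⟩
      exact ConcreteCategory.congr_hom (F.map_id ⟨i⟩) _)
    exact ⟨x, funext fun j => hx ⟨j⟩, fun z hz => hx' z fun j => congrFun hz j.as⟩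
  · intro h s _
    obtain ⟨x, hx, hx'⟩ := h (fun j => s ⟨j⟩)
    exact ⟨x, fun j => congrFun hx j.as, fun z hz => hx' z (funext fun j => hz ⟨j⟩)⟩

/-- A functor to abelian groups preserves products of shape `J` iff it does so on elements. -/
lemma preservesProducts_iff_bijective {C : Type*} [Category* C] (J : Type u)
    (F : C ⥤ AddCommGrpCat.{u}) : PreservesLimitsOfShape (Discrete J) F ↔
      ∀ (t : Discrete J ⥤ C) (c : Cone t) (_ : IsLimit c), Function.Bijective
        (fun (x : F.obj c.pt) (j : J) => (F.map (c.π.app ⟨j⟩) x : F.obj (t.obj ⟨j⟩))) := by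
  constructor
  · intro _ t c hc
    exact (nonempty_isLimit_iff_bijective (F.mapCone c)).1 ⟨isLimitOfPreserves F hc⟩
  · intro h
    exact ⟨⟨fun hc => (nonempty_isLimit_iff_bijective (F.mapCone _)).2 (h _ _ hc)⟩⟩

/-- A cocone over a filtered diagram of abelian groups is a colimit cocone if it is jointly
surjective and elements that become zero in the point become zero in the diagram. -/
lemma nonempty_isColimit_of_isFiltered {J : Type u} [SmallCategory J] [IsFiltered J]
    {F : J ⥤ AddCommGrpCat.{u}} (c : Cocone F)
    (hsurj : ∀ x : c.pt, ∃ (j : J) (y : F.obj j), c.ι.app j y = x)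
    (hinj : ∀ (j : J) (y : F.obj j), c.ι.app j y = 0 → ∃ (k : J) (f : j ⟶ k), F.map f y = 0) :
    Nonempty (IsColimit c) := by
  have : ReflectsColimitsOfShape J (forget AddCommGrpCat.{u}) :=
    reflectsColimitsOfShape_of_reflectsIsomorphisms
  refine ⟨isColimitOfReflects (forget AddCommGrpCat.{u})
    (Types.FilteredColimit.isColimitOf' _ _ (fun x => ?_) (fun j x y h => ?_))⟩
  · obtain ⟨j, y, hy⟩ := hsurj x
    exact ⟨j, y, hy.symm⟩
  · have h' : (c.ι.app j) x = c.ι.app j y := h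
    obtain ⟨k, f, hf⟩ := hinj j ((show F.obj j from x) - y) (by
      rw [map_sub, h', sub_self])
    refine ⟨k, f, ?_⟩
    rw [map_sub, sub_eq_zero] at hf
    exact hf

section Filtered

variable {J : Type u} [SmallCategory J] [IsFiltered J] {F : J ⥤ AddCommGrpCat.{u}} {c : Cocone F}

lemma exists_rep_of_isColimit (hc : IsColimit c) (x : c.pt) :
    ∃ (j : J) (y : F.obj j), c.ι.app j y = x :=
  Concrete.isColimit_exists_rep F hc x

lemma exists_map_eq_of_isColimit (hc : IsColimit c) {j : J} (x y : F.obj j)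
    (h : c.ι.app j x = c.ι.app j y) : ∃ (k : J) (f : j ⟶ k), F.map f x = F.map f y := by
  obtain ⟨k, f, g, h⟩ := Concrete.isColimit_exists_of_rep_eq F hc x y h
  refine ⟨IsFiltered.coeq f g, f ≫ IsFiltered.coeqHom f g, ?_⟩
  rw [Functor.map_comp, ConcreteCategory.comp_apply, h, ← ConcreteCategory.comp_apply,
    ← Functor.map_comp, ← IsFiltered.coeq_condition, Functor.map_comp,
    ConcreteCategory.comp_apply]

lemma exists_map_eq_zero_of_isColimit (hc : IsColimit c) {j : J} (x : F.obj j)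
    (h : c.ι.app j x = 0) : ∃ (k : J) (f : j ⟶ k), F.map f x = 0 := by
  obtain ⟨k, f, hf⟩ := exists_map_eq_of_isColimit hc x 0 (by rw [h, map_zero])
  exact ⟨k, f, by rw [hf, map_zero]⟩

end Filtered

/-! ### Closure of the product-preserving modules -/

section Closure

variable {R : Type u} [SmallCategory R] [Preadditive R]

instance (J : Type u) [SmallCategory J] :
    (additiveFunctor R AddCommGrpCat.{u}).IsClosedUnderLimitsOfShape J where
  limitsOfShape_le := by
    rintro G ⟨h⟩
    refine ⟨fun {X Y f g} => (isLimitOfPreserves ((evaluation _ _).obj Y) h.isLimit).hom_ext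
      fun j => ?_⟩
    have : (h.diag.obj j).Additive := h.prop_diag_obj j
    simp [Preadditive.add_comp]

instance (J : Type u) [SmallCategory J] :
    (additiveFunctor R AddCommGrpCat.{u}).IsClosedUnderColimitsOfShape J where
  colimitsOfShape_le := by
    rintro G ⟨h⟩
    refine ⟨fun {X Y f g} => (isColimitOfPreserves ((evaluation _ _).obj X) h.isColimit).hom_ext
      fun j => ?_⟩
    have : (h.diag.obj j).Additive := h.prop_diag_obj j
    simp [Preadditive.comp_add, ← NatTrans.naturality]

/-- Evaluation of left modules at an object. -/
abbrev evalMod (n : R) : LeftMod R ⥤ AddCommGrpCat.{u} :=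
  (additiveFunctor R AddCommGrpCat.{u}).ι ⋙ (evaluation _ _).obj n

lemma bijective_of_isLimit {J : Type u} {K : Discrete J ⥤ LeftMod R} {c : Cone K}
    (hc : IsLimit c) (n : R) : Function.Bijective
      (fun (x : c.pt.obj.obj n) (j : J) => ((c.π.app ⟨j⟩).hom.app n x : (K.obj ⟨j⟩).obj.obj n)) :=
  (nonempty_isLimit_iff_bijective ((evalMod n).mapCone c)).1 ⟨isLimitOfPreserves _ hc⟩

section

variable {J : Type u} [SmallCategory J] [IsFiltered J] {K : J ⥤ LeftMod R} {c : Cocone K}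

lemma exists_rep (hc : IsColimit c) {n : R} (x : c.pt.obj.obj n) :
    ∃ (j : J) (y : (K.obj j).obj.obj n), (c.ι.app j).hom.app n y = x :=
  exists_rep_of_isColimit (isColimitOfPreserves (evalMod n) hc) x

lemma exists_map_eq (hc : IsColimit c) {n : R} {j : J} (x y : (K.obj j).obj.obj n)
    (h : (c.ι.app j).hom.app n x = (c.ι.app j).hom.app n y) :
    ∃ (k : J) (f : j ⟶ k), (K.map f).hom.app n x = (K.map f).hom.app n y :=
  exists_map_eq_of_isColimit (isColimitOfPreserves (evalMod n) hc) x y h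

end

lemma cocone_w_apply {J : Type u} [SmallCategory J] {K : J ⥤ LeftMod R} (c : Cocone K)
    {i j : J} (f : i ⟶ j) {n : R} (x : (K.obj i).obj.obj n) :
    (c.ι.app j).hom.app n ((K.map f).hom.app n x) = (c.ι.app i).hom.app n x := by
  rw [← c.w f]
  rfl

instance (κ : Cardinal.{u}) (J : Type u) :
    (preservesSmallProducts κ R).IsClosedUnderLimitsOfShape (Discrete J) where
  limitsOfShape_le := by
    rintro G ⟨h⟩ I hI
    rw [preservesProducts_iff_bijective]
    intro t c hc
    have key (j : J) := (preservesProducts_iff_bijective I _).1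
      (h.prop_diag_obj ⟨j⟩ I hI) t c hc
    have hb := bijective_of_isLimit h.isLimit
    constructor
    · intro x y hxy
      refine (hb _).1 (funext fun j => (key j).1 (funext fun i => ?_))
      have := congrFun hxy i
      dsimp at this ⊢
      rw [← NatTrans.naturality_apply, ← NatTrans.naturality_apply]
      exact congrArg _ this
    · intro x
      choose y hy using fun j => (key j).2 (fun i => (h.π.app ⟨j⟩).hom.app _ (x i))
      obtain ⟨z, hz⟩ := (hb _).2 y
      refine ⟨z, funext fun i => (hb _).1 (funext fun j => ?_)⟩
      have h₁ := congrFun hz j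
      have h₂ := congrFun (hy j) i
      dsimp at h₁ h₂ ⊢
      rw [NatTrans.naturality_apply]
      exact (congrArg _ h₁).trans h₂

/-- `κ`-filtered colimits commute with `κ`-small products in `Ab`: data chosen at fewer than `κ`
indices can be moved to a common one. -/
lemma isClosedUnderColimitsOfShape_preservesSmallProducts (κ : Cardinal.{u}) [Fact κ.IsRegular]
    (J : Type u) [SmallCategory J] [IsCardinalFiltered J κ] :
    (preservesSmallProducts κ R).IsClosedUnderColimitsOfShape J where
  colimitsOfShape_le := by
    rintro G ⟨h⟩ I hI
    have := isFiltered_of_isCardinalFiltered J κ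
    have hI' : HasCardinalLT I κ := by rwa [hasCardinalLT_iff_cardinal_mk_lt]
    rw [preservesProducts_iff_bijective]
    intro t c hc
    have key (j : J) := (preservesProducts_iff_bijective I _).1 (h.prop_diag_obj j I hI) t c hc
    constructor
    · refine injective_pi_of_forall_eq_zero (A := G.obj.obj c.pt)
        (B := fun i => G.obj.obj (t.obj ⟨i⟩)) (fun i => (G.obj.map (c.π.app ⟨i⟩)).hom) ?_
      intro x hx
      obtain ⟨j, y, rfl⟩ := exists_rep h.isColimit x
      have hy (i : I) : (h.ι.app j).hom.app _ ((h.diag.obj j).obj.map (c.π.app ⟨i⟩) y) =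
          (h.ι.app j).hom.app _ 0 := by
        rw [NatTrans.naturality_apply, map_zero]
        exact hx i
      choose k f hf using fun i => exists_map_eq h.isColimit _ _ (hy i)
      -- Each `f i` kills only the `i`-th component of `y`; a common composite `b` kills all of
      -- them.
      obtain ⟨m, a, b, hab⟩ := IsCardinalFiltered.wideSpan f hI'
      have hb : (h.diag.map b).hom.app _ y = 0 := by
        refine (key m).1 (funext fun i => ?_)
        dsimp
        rw [← NatTrans.naturality_apply, ← hab i, Functor.map_comp, map_zero]
        refine (congrArg ((h.diag.map (a i)).hom.app _) (hf i)).trans ?_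
        rw [map_zero, map_zero]
      refine (cocone_w_apply h.cocone b y).symm.trans ?_
      rw [hb, map_zero]
    · intro x
      choose j y hy using fun i => exists_rep h.isColimit (x i)
      obtain ⟨z, hz⟩ := (key (IsCardinalFiltered.max j hI')).2
        (fun i => (h.diag.map (IsCardinalFiltered.toMax j hI' i)).hom.app _ (y i))
      refine ⟨(h.ι.app _).hom.app _ z, funext fun i => ?_⟩
      have hz := congrFun hz i
      dsimp at hz ⊢
      rw [← NatTrans.naturality_apply]
      refine (congrArg _ hz).trans ?_
      exact (cocone_w_apply h.cocone (IsCardinalFiltered.toMax j hI' i) _).trans (hy i)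

end Closure

variable {R : Type u} [SmallCategory R] [Preadditive R]

instance (κ : Cardinal.{u}) [Fact κ.IsRegular] :
    (preservesSmallProducts κ R).ι.IsCardinalAccessible κ where
  preservesColimitOfShape J _ _ := by
    have := isClosedUnderColimitsOfShape_preservesSmallProducts (R := R) κ J
    infer_instance

lemma funCard_restrict (κ : Cardinal.{u}) [Fact κ.IsRegular]
    {F : LeftMod R ⥤ AddCommGrpCat.{u}} (hF : funFin (LeftMod R) F) :
    funCard κ (ProdMod κ R) (restrict κ F) := by
  obtain ⟨h₁, h₂⟩ := hF
  have : Fact (Cardinal.aleph0.{u}).IsRegular := Cardinal.fact_isRegular_aleph0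
  have := F.isCardinalAccessible_of_le (Cardinal.IsRegular.aleph0_le (Fact.out : κ.IsRegular))
  exact ⟨inferInstance, fun J => have := h₂ J; inferInstance⟩

lemma funCard_of_iso (κ : Cardinal.{u}) [Fact κ.IsRegular] {C : Type (u + 1)} [Category.{u} C]
    {F G : C ⥤ AddCommGrpCat.{u}} (e : F ≅ G) (hF : funCard κ C F) : funCard κ C G := by
  obtain ⟨h₁, h₂⟩ := hF
  exact ⟨Functor.isCardinalAccessible_of_natIso e κ,
    fun J => have := h₂ J; preservesLimitsOfShape_of_natIso e⟩

/-! ### Pp-pairs commute with filtered colimits and products -/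

namespace PPFormula

variable {n : R} (φ : PPFormula R n)

/-- Solutions of a pp-formula in a filtered colimit come from solutions in the diagram. -/
lemma exists_sol_of_isColimit {J : Type u} [SmallCategory J] [IsFiltered J] {K : J ⥤ LeftMod R}
    {c : Cocone K} (hc : IsColimit c) {j : J} (x : (K.obj j).obj.obj n)
    (hx : (c.ι.app j).hom.app n x ∈ φ.sol c.pt) :
    ∃ (k : J) (f : j ⟶ k), (K.map f).hom.app n x ∈ φ.sol (K.obj k) := by
  obtain ⟨y, hy⟩ := hx
  obtain ⟨i, y, rfl⟩ := exists_rep hc y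
  let k := IsFiltered.max j i
  obtain ⟨l, f, hf⟩ := exists_map_eq hc (j := k)
    ((K.obj k).obj.map φ.A ((K.map (IsFiltered.leftToMax j i)).hom.app n x))
    ((K.obj k).obj.map φ.B ((K.map (IsFiltered.rightToMax j i)).hom.app φ.l y)) (by
      rw [NatTrans.naturality_apply, NatTrans.naturality_apply, cocone_w_apply,
        cocone_w_apply]
      exact hy)
  refine ⟨l, IsFiltered.leftToMax j i ≫ f,
    (K.map (IsFiltered.rightToMax j i ≫ f)).hom.app φ.l y, ?_⟩
  rw [NatTrans.naturality_apply, NatTrans.naturality_apply] at hf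
  rw [Functor.map_comp, Functor.map_comp]
  exact hf

/-- A family is a solution of a pp-formula in a product if all its components are. -/
lemma mem_sol_of_isLimit {J : Type u} {K : Discrete J ⥤ LeftMod R} {c : Cone K}
    (hc : IsLimit c) (x : c.pt.obj.obj n)
    (hx : ∀ j, (c.π.app j).hom.app n x ∈ φ.sol (K.obj j)) : x ∈ φ.sol c.pt := by
  choose y hy using hx
  obtain ⟨z, hz⟩ := (bijective_of_isLimit hc φ.l).2 (fun j => y ⟨j⟩)
  refine ⟨z, (bijective_of_isLimit hc φ.m).1 (funext fun j => ?_)⟩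
  have hz := congrFun hz j
  dsimp at hz ⊢
  rw [NatTrans.naturality_apply, NatTrans.naturality_apply, hz]
  exact hy ⟨j⟩

end PPFormula

namespace PPPair

variable {n : R} (p : PPPair R n)

/-- The class of a solution of `φ` in `F_{φ/ψ} M`. -/
def cls {M : LeftMod R} (x : M.obj.obj n) (hx : x ∈ p.φ.sol M) : p.functor.obj M :=
  QuotientAddGroup.mk (⟨x, hx⟩ : p.φ.sol M)

lemma cls_surjective {M : LeftMod R} (y : p.functor.obj M) :
    ∃ (x : M.obj.obj n) (hx : x ∈ p.φ.sol M), p.cls x hx = y := by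
  obtain ⟨⟨x, hx⟩, rfl⟩ := QuotientAddGroup.mk_surjective y
  exact ⟨x, hx, rfl⟩

lemma cls_eq_zero_iff {M : LeftMod R} (x : M.obj.obj n) (hx : x ∈ p.φ.sol M) :
    p.cls x hx = 0 ↔ x ∈ p.ψ.sol M :=
  (QuotientAddGroup.eq_zero_iff _).trans AddSubgroup.mem_addSubgroupOf

lemma map_cls {M N : LeftMod R} (f : M ⟶ N) (x : M.obj.obj n) (hx : x ∈ p.φ.sol M) :
    p.functor.map f (p.cls x hx) = p.cls (f.hom.app n x) (p.φ.sol_map f hx) :=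
  rfl

lemma funFin_functor : funFin (LeftMod R) p.functor := by
  have : Fact (Cardinal.aleph0.{u}).IsRegular := Cardinal.fact_isRegular_aleph0
  refine ⟨⟨fun J _ hJ => ?_⟩, fun J => ?_⟩
  · have := isFiltered_of_isCardinalFiltered J Cardinal.aleph0.{u}
    refine ⟨⟨fun {c} hc => nonempty_isColimit_of_isFiltered _ (fun y => ?_) (fun j y hy => ?_)⟩⟩
    · obtain ⟨x, hx, rfl⟩ := p.cls_surjective y
      obtain ⟨j, x, rfl⟩ := exists_rep hc x
      obtain ⟨k, f, hf⟩ := p.φ.exists_sol_of_isColimit hc x hx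
      refine ⟨k, p.cls _ hf, ?_⟩
      refine (p.map_cls _ _ _).trans ?_
      congr 1
      exact cocone_w_apply c f x
    · obtain ⟨x, hx, rfl⟩ := p.cls_surjective y
      have hy : p.functor.map (c.ι.app j) (p.cls x hx) = 0 := hy
      rw [map_cls, cls_eq_zero_iff] at hy
      obtain ⟨k, f, hf⟩ := p.ψ.exists_sol_of_isColimit hc x hy
      exact ⟨k, f, (p.cls_eq_zero_iff _ (p.φ.sol_map _ hx)).2 hf⟩
  · rw [preservesProducts_iff_bijective]
    intro t c hc
    constructor
    · refine injective_pi_of_forall_eq_zero (A := p.functor.obj c.pt)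
        (B := fun j => p.functor.obj (t.obj ⟨j⟩)) (fun j => (p.functor.map (c.π.app ⟨j⟩)).hom) ?_
      intro y hy
      obtain ⟨x, hx, rfl⟩ := p.cls_surjective y
      rw [cls_eq_zero_iff]
      exact p.ψ.mem_sol_of_isLimit hc x fun j => (p.cls_eq_zero_iff _ _).1 (hy j.as)
    · intro y
      choose x hx hxy using fun j => p.cls_surjective (y j)
      obtain ⟨z, hz⟩ := (bijective_of_isLimit hc n).2 x
      have hz (j : J) : (c.π.app ⟨j⟩).hom.app n z = x j := congrFun hz j
      refine ⟨p.cls z (p.φ.mem_sol_of_isLimit hc z fun j => ?_), funext fun j => ?_⟩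
      · exact (hz j.as).symm ▸ hx j.as
      · refine (p.map_cls _ _ _).trans ((?_ : _ = _).trans (hxy j))
        congr 1
        exact hz j

end PPPair

/-! ### From isomorphic to equal restrictions -/

/-- Replacing a functor up to isomorphism, an isomorphism with a restriction becomes an equality. -/
lemma exists_iso_restrict_eq (κ : Cardinal.{u}) {G : ProdMod κ R ⥤ AddCommGrpCat.{u}}
    {F : LeftMod R ⥤ AddCommGrpCat.{u}} (e : restrict κ F ≅ G) :
    ∃ F' : LeftMod R ⥤ AddCommGrpCat.{u}, Nonempty (F ≅ F') ∧ G = restrict κ F' := by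
  classical
  let obj (M : LeftMod R) : Σ A : AddCommGrpCat.{u}, (F.obj M ≅ A) :=
    if h : preservesSmallProducts κ R M then ⟨G.obj ⟨M, h⟩, e.app ⟨M, h⟩⟩ else ⟨_, Iso.refl _⟩
  have hobj (M : ProdMod κ R) : obj M.obj = ⟨G.obj M, e.app M⟩ := dif_pos M.property
  refine ⟨F.copyObj (fun M => (obj M).1) (fun M => (obj M).2), ⟨F.isoCopyObj _ _⟩, ?_⟩
  -- Stated for arbitrary `a` and `b`, so that an object and its isomorphism are substituted
  -- together and no transport appears.
  have key (M N : ProdMod κ R) (f : M ⟶ N) (a : Σ A : AddCommGrpCat.{u}, (F.obj M.obj ≅ A))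
      (b : Σ A : AddCommGrpCat.{u}, (F.obj N.obj ≅ A)) (ha : a = ⟨G.obj M, e.app M⟩)
      (hb : b = ⟨G.obj N, e.app N⟩) :
      HEq (G.map f) (a.2.inv ≫ F.map f.hom ≫ b.2.hom) := by
    subst ha hb
    refine heq_of_eq ?_
    have := e.hom.naturality f
    simp_all
  exact Functor.hext (fun M => (congrArg Sigma.fst (hobj M)).symm)
    (fun M N f => key M N f _ _ (hobj M) (hobj N))

/-! ### Modules with one generator and one relation -/

/-- A morphism `n ⟶ m` of `R`, regarded as a presentation of a left `R`-module by a generator in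
degree `n` and a relation in degree `m`. -/
structure Presentation (R : Type u) [SmallCategory R] where
  n : R
  m : R
  A : n ⟶ m

namespace Presentation

variable (P : Presentation R)

/-- The morphisms `n ⟶ t` that factor through the relation. -/
def relations (t : R) : AddSubgroup (P.n ⟶ t) :=
  (Preadditive.leftComp t P.A).range

/-- The underlying functor of the presented module: the cokernel of `R(m, -) ⟶ R(n, -)`. -/
def functor : R ⥤ AddCommGrpCat.{u} where
  obj t := AddCommGrpCat.of ((P.n ⟶ t) ⧸ P.relations t)
  map {s t} f := AddCommGrpCat.ofHom
    (QuotientAddGroup.map (P.relations s) (P.relations t) (Preadditive.rightComp P.n f) (by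
      rintro _ ⟨g, rfl⟩
      exact ⟨g ≫ f, (Category.assoc _ _ _).symm⟩))
  map_id t := by
    ext x
    exact congrArg QuotientAddGroup.mk (Category.comp_id x)
  map_comp f g := by
    ext x
    exact congrArg QuotientAddGroup.mk (Category.assoc x f g).symm

/-- The class of a morphism in the presented module. -/
def cls {t : R} : (P.n ⟶ t) →+ P.functor.obj t :=
  QuotientAddGroup.mk' (P.relations t)

lemma cls_surjective {t : R} (x : P.functor.obj t) : ∃ f : P.n ⟶ t, P.cls f = x :=
  QuotientAddGroup.mk_surjective x

lemma cls_eq_zero_iff {t : R} {f : P.n ⟶ t} : P.cls f = 0 ↔ ∃ g : P.m ⟶ t, P.A ≫ g = f :=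
  QuotientAddGroup.eq_zero_iff f

lemma map_cls {s t : R} (f : P.n ⟶ s) (g : s ⟶ t) : P.functor.map g (P.cls f) = P.cls (f ≫ g) :=
  rfl

instance : P.functor.Additive where
  map_add {s t f g} := by
    ext x
    obtain ⟨x, rfl⟩ := P.cls_surjective x
    refine (congrArg P.cls (Preadditive.comp_add _ _ _ x f g)).trans ?_
    exact map_add P.cls _ _

/-- The presented left module. -/
abbrev module : LeftMod R := ⟨P.functor, (inferInstance : P.functor.Additive)⟩

/-- The generator of the presented module. -/
abbrev gen : P.module.obj.obj P.n := P.cls (𝟙 P.n)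

lemma map_gen {t : R} (f : P.n ⟶ t) : P.module.obj.map f P.gen = P.cls f := by
  rw [map_cls, Category.id_comp]

lemma map_A_gen : P.module.obj.map P.A P.gen = 0 := by
  rw [map_gen, cls_eq_zero_iff]
  exact ⟨𝟙 _, Category.comp_id _⟩

variable {P} in
lemma app_cls {M : LeftMod R} (f : P.module ⟶ M) {t : R} (h : P.n ⟶ t) :
    f.hom.app t (P.cls h) = M.obj.map h (f.hom.app P.n P.gen) := by
  rw [← map_gen, NatTrans.naturality_apply]

variable {P} in
lemma hom_ext {M : LeftMod R} {f g : P.module ⟶ M}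
    (h : f.hom.app P.n P.gen = g.hom.app P.n P.gen) : f = g := by
  ext t x
  obtain ⟨x, rfl⟩ := P.cls_surjective x
  exact (app_cls f x).trans ((congrArg _ h).trans (app_cls g x).symm)

/-- An element satisfying the relation defines a morphism from the presented module. -/
def desc {M : LeftMod R} (x : M.obj.obj P.n) (hx : M.obj.map P.A x = 0) : P.module ⟶ M :=
  ObjectProperty.homMk
    { app t := AddCommGrpCat.ofHom (QuotientAddGroup.lift (P.relations t)
        { toFun f := M.obj.map f x
          map_zero' := by simp
          map_add' f g := by simp [Functor.map_add] } (by
            rintro _ ⟨g, rfl⟩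
            change M.obj.map (P.A ≫ g) x = 0
            rw [Functor.map_comp, ConcreteCategory.comp_apply, hx, map_zero]))
      naturality s t f := by
        ext y
        obtain ⟨y, rfl⟩ := P.cls_surjective y
        change M.obj.map (y ≫ f) x = M.obj.map f (M.obj.map y x)
        rw [Functor.map_comp, ConcreteCategory.comp_apply] }

@[simp]
lemma desc_gen {M : LeftMod R} (x : M.obj.obj P.n) (hx : M.obj.map P.A x = 0) :
    (P.desc x hx).hom.app P.n P.gen = x := by
  change M.obj.map (𝟙 _) x = x
  simp

lemma map_A_app_gen {M : LeftMod R} (f : P.module ⟶ M) :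
    M.obj.map P.A (f.hom.app P.n P.gen) = 0 := by
  rw [← NatTrans.naturality_apply, map_A_gen, map_zero]

/-- Representables preserve products and products are exact in `Ab`, so a cokernel of representables
preserves products. -/
lemma preservesSmallProducts_module (κ : Cardinal.{u}) : preservesSmallProducts κ R P.module := by
  intro J _
  rw [preservesProducts_iff_bijective]
  intro t c hc
  constructor
  · refine injective_pi_of_forall_eq_zero (A := P.functor.obj c.pt)
      (B := fun j => P.functor.obj (t.obj ⟨j⟩)) (fun j => (P.functor.map (c.π.app ⟨j⟩)).hom) ?_
    intro x hx
    obtain ⟨f, rfl⟩ := P.cls_surjective x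
    choose g hg using fun j => P.cls_eq_zero_iff.1 (hx j)
    refine P.cls_eq_zero_iff.2 ⟨hc.lift ⟨P.m, Discrete.natTrans fun j => g j.as⟩, ?_⟩
    refine hc.hom_ext fun j => ?_
    rw [Category.assoc, hc.fac]
    exact hg j.as
  · intro x
    choose f hf using fun j => P.cls_surjective (x j)
    refine ⟨P.cls (hc.lift ⟨P.n, Discrete.natTrans fun j => f j.as⟩), funext fun j => ?_⟩
    refine Eq.trans ?_ (hf j)
    exact congrArg P.cls (hc.fac _ _)

/-- The presented module as an object of `ProdMod κ R`. -/
abbrev prodMod (κ : Cardinal.{u}) : ProdMod κ R := ⟨P.module, P.preservesSmallProducts_module κ⟩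

end Presentation

variable {κ : Cardinal.{u}}

/-! ### The canonical diagram of presented modules over `X` -/

/-- The presented modules over a given object of `ProdMod κ R`. -/
abbrev presentedOver (X : ProdMod κ R) (a : Σ P : Presentation R, P.prodMod κ ⟶ X) : Over X :=
  Over.mk a.2

/-- The category of presented modules over a given object of `ProdMod κ R`. -/
abbrev PresentedOver (X : ProdMod κ R) : Type u := InducedCategory (Over X) (presentedOver X)

namespace PresentedOver

variable {X : ProdMod κ R}

/-- The object of `PresentedOver X` given by an element of `X` satisfying the relation. -/
def of (P : Presentation R) (x : X.obj.obj.obj P.n) (hx : X.obj.obj.map P.A x = 0) :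
    PresentedOver X :=
  ⟨P, ObjectProperty.homMk (P.desc x hx)⟩

/-- The element of `X` corresponding to an object of `PresentedOver X`. -/
def elt (j : PresentedOver X) : X.obj.obj.obj j.1.n := j.2.hom.hom.app _ j.1.gen

@[simp]
lemma elt_of (P : Presentation R) (x : X.obj.obj.obj P.n) (hx : X.obj.obj.map P.A x = 0) :
    (of P x hx).elt = x :=
  P.desc_gen x hx

lemma map_A_elt (j : PresentedOver X) : X.obj.obj.map j.1.A j.elt = 0 :=
  j.1.map_A_app_gen _

/-- A morphism in `PresentedOver X` is given by the image of the generator. -/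
lemma exists_hom {j k : PresentedOver X} (e : k.1.n ⟶ j.1.n) (he : k.1.cls (e ≫ j.1.A) = 0)
    (h : X.obj.obj.map e k.elt = j.elt) :
    ∃ f : j ⟶ k, f.hom.left.hom.hom.app _ j.1.gen = k.1.cls e := by
  let f : j.1.module ⟶ k.1.module := j.1.desc (k.1.cls e) he
  refine ⟨InducedCategory.homMk (Over.homMk (ObjectProperty.homMk f) ?_),
    j.1.desc_gen (M := k.1.module) _ he⟩
  ext : 1
  refine Presentation.hom_ext ?_
  refine Eq.trans ?_ h
  refine (congrArg (k.2.hom.hom.app _) (j.1.desc_gen (M := k.1.module) (k.1.cls e) he)).trans ?_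
  exact Presentation.app_cls k.2.hom e

lemma w_app {j k : PresentedOver X} (f : j ⟶ k) {t : R} (x : j.1.module.obj.obj t) :
    k.2.hom.hom.app t (f.hom.left.hom.hom.app t x) = j.2.hom.hom.app t x := by
  have := congrArg (fun g => g.hom.hom.app t x) (Over.w f.hom)
  exact this

lemma hom_ext {j k : PresentedOver X} {f g : j ⟶ k}
    (h : f.hom.left.hom.hom.app _ j.1.gen = g.hom.left.hom.hom.app _ j.1.gen) : f = g := by
  ext : 3
  exact Presentation.hom_ext h

lemma eq_zero_of_forall_map_π {ι : Type u} (hι : Cardinal.mk ι < κ) (t : ι → R)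
    [HasProduct t] (x : X.obj.obj.obj (∏ᶜ t)) (hx : ∀ i, X.obj.obj.map (Pi.π t i) x = 0) :
    x = 0 := by
  have := (preservesProducts_iff_bijective ι _).1 (X.property ι hι) _ _
    (limit.isLimit (Discrete.functor t))
  refine this.1 (funext fun i => (hx i).trans (map_zero _).symm)

/-- The elements given by the `j i` form one element of `X` at the product of the generator degrees,
subject to the product of the relations; the projections induce the morphisms. -/
lemma exists_forall_hom (hR : HasSmallProducts κ R) {ι : Type u}
    (hι : Cardinal.mk ι < κ) (j : ι → PresentedOver X) :
    ∃ k : PresentedOver X, ∀ i, Nonempty (j i ⟶ k) := by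
  have := hR ι hι
  let P : Presentation R := ⟨_, _, Limits.Pi.map fun i => (j i).1.A⟩
  obtain ⟨x, hx⟩ := ((preservesProducts_iff_bijective ι _).1 (X.property ι hι) _ _
    (limit.isLimit (Discrete.functor fun i => (j i).1.n))).2 (fun i => (j i).elt)
  have hx (i : ι) : X.obj.obj.map (Pi.π (fun i => (j i).1.n) i) x = (j i).elt := congrFun hx i
  have hP (i : ι) : P.A ≫ Pi.π (fun i => (j i).1.m) i = Pi.π (fun i => (j i).1.n) i ≫ (j i).1.A :=
    Limits.Pi.map_π (fun i => (j i).1.A) i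
  refine ⟨of P x ?_, fun i => ?_⟩
  · refine eq_zero_of_forall_map_π hι _ _ fun i => ?_
    rw [← ConcreteCategory.comp_apply, ← Functor.map_comp]
    rw [hP, Functor.map_comp, ConcreteCategory.comp_apply, hx]
    exact (j i).map_A_elt
  · refine ⟨(exists_hom (j := j i) (k := of P x _) (Pi.π (fun i => (j i).1.n) i)
      (P.cls_eq_zero_iff.2 ⟨Pi.π _ i, hP i⟩) ?_).choose⟩
    exact (congrArg _ (elt_of P x _)).trans (hx i)

/-- Fewer than `κ` elements of a presented module that vanish in `X` can be killed. -/
lemma exists_hom_forall_eq_zero [HasBinaryBiproducts R]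
    (hR : HasSmallProducts κ R) {ι : Type u} (hι : Cardinal.mk ι < κ)
    (j : PresentedOver X) (t : ι → R) (y : ∀ i, j.1.module.obj.obj (t i))
    (hy : ∀ i, j.2.hom.hom.app _ (y i) = 0) :
    ∃ (k : PresentedOver X) (f : j ⟶ k), ∀ i, f.hom.left.hom.hom.app _ (y i) = 0 := by
  have := hR ι hι
  choose e he using fun i => j.1.cls_surjective (y i)
  have hxe (i : ι) : X.obj.obj.map (e i) j.elt = 0 := by
    rw [← hy i, ← he i]
    exact (Presentation.app_cls j.2.hom (e i)).symm
  -- The generator is kept; the new relation imposes the old one together with all `e i = 0`.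
  let P : Presentation R := ⟨_, _, biprod.lift j.1.A (Pi.lift e)⟩
  have hx : X.obj.obj.map P.A j.elt = 0 := by
    have h₁ : X.obj.obj.map (Pi.lift e) j.elt = 0 := by
      refine eq_zero_of_forall_map_π hι _ _ fun i => ?_
      rw [← ConcreteCategory.comp_apply, ← Functor.map_comp, Pi.lift_π, hxe]
    have h₂ : P.A = j.1.A ≫ biprod.inl + Pi.lift e ≫ biprod.inr := by
      ext <;> simp [P]
    rw [h₂, Functor.map_add, Functor.map_comp, Functor.map_comp]
    change X.obj.obj.map biprod.inl (X.obj.obj.map j.1.A j.elt) +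
      X.obj.obj.map biprod.inr (X.obj.obj.map (Pi.lift e) j.elt) = 0
    rw [h₁, map_A_elt, map_zero, map_zero, add_zero]
  obtain ⟨f, hf⟩ := exists_hom (j := j) (k := of P j.elt hx) (𝟙 j.1.n)
    (P.cls_eq_zero_iff.2 ⟨biprod.fst, (biprod.lift_fst _ _).trans (Category.id_comp _).symm⟩)
    ((congrArg _ (elt_of P j.elt hx)).trans (ConcreteCategory.congr_hom (X.obj.obj.map_id _) _))
  refine ⟨of P j.elt hx, f, fun i => ?_⟩
  rw [← he i]
  refine (Presentation.app_cls f.hom.left.hom (e i)).trans ?_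
  rw [hf]
  exact P.cls_eq_zero_iff.2 ⟨biprod.snd ≫ Pi.π _ i,
    Eq.trans (by simp [P]) (Category.id_comp (e i)).symm⟩

lemma isCardinalFiltered [Fact κ.IsRegular] [HasBinaryBiproducts R]
    (hR : HasSmallProducts κ R) :
    IsCardinalFiltered (PresentedOver X) κ := by
  have hκ : Cardinal.aleph0 ≤ κ := Cardinal.IsRegular.aleph0_le Fact.out
  rw [isCardinalFiltered_iff]
  refine ⟨fun ι j hι => exists_forall_hom hR ((hasCardinalLT_iff_cardinal_mk_lt _ _).1 hι) j,
    fun ι j k f hι => ?_⟩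
  -- Without arrows an upper bound of `j` and `k` suffices; otherwise all arrows are compared with
  -- `f i₀`, by killing the differences of the images of the generator, which vanish in `X`.
  obtain hι' | ⟨⟨i₀⟩⟩ := isEmpty_or_nonempty ι
  · obtain ⟨l, hl⟩ := exists_forall_hom hR (ι := ULift.{u} Bool)
      ((Cardinal.mk_lt_aleph0).trans_le hκ) (fun b => if b.down then k else j)
    exact ⟨l, (hl ⟨true⟩).some, (hl ⟨false⟩).some, fun i => hι'.elim i⟩
  · obtain ⟨l, g, hg⟩ := exists_hom_forall_eq_zero hR
      ((hasCardinalLT_iff_cardinal_mk_lt _ _).1 hι) k (fun _ => j.1.n)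
      (fun i => (show k.1.module.obj.obj j.1.n from (f i).hom.left.hom.hom.app _ j.1.gen) -
        (show k.1.module.obj.obj j.1.n from (f i₀).hom.left.hom.hom.app _ j.1.gen)) (fun i => by
          rw [map_sub, sub_eq_zero]
          exact (w_app (f i) j.1.gen).trans (w_app (f i₀) j.1.gen).symm)
    refine ⟨l, g, f i₀ ≫ g, fun i => hom_ext ?_⟩
    have := hg i
    rw [map_sub, sub_eq_zero] at this
    exact this

variable (X) in
/-- The diagram of presented modules over `X`. -/
abbrev diagram : PresentedOver X ⥤ ProdMod κ R := inducedFunctor (presentedOver X) ⋙ Over.forget X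

variable (X) in
/-- The canonical cocone with point `X` over the diagram of presented modules over `X`. -/
abbrev cocone : Cocone (diagram X) := (Over.forgetCocone X).whisker (inducedFunctor _)

/-- Every object of `ProdMod κ R` is the colimit of the presented modules over it. -/
lemma nonempty_isColimit_cocone [Fact κ.IsRegular] [HasBinaryBiproducts R]
    (hR : HasSmallProducts κ R) :
    Nonempty (IsColimit (cocone X)) := by
  have := isCardinalFiltered (X := X) hR
  have := isFiltered_of_isCardinalFiltered (PresentedOver X) κ
  let Φ := (preservesSmallProducts κ R).ι ⋙ (additiveFunctor R AddCommGrpCat.{u}).ι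
  refine ⟨isColimitOfReflects Φ (evaluationJointlyReflectsColimits _ fun t => Nonempty.some ?_)⟩
  refine nonempty_isColimit_of_isFiltered _ (fun (x : X.obj.obj.obj t) => ?_)
    (fun (j : PresentedOver X) (y : j.1.module.obj.obj t) hy => ?_)
  · let P : Presentation R := ⟨t, t, 0⟩
    have hx : X.obj.obj.map P.A x = 0 := by simp [P]
    exact ⟨of P x hx, P.gen, P.desc_gen x hx⟩
  · obtain ⟨k, f, hf⟩ := exists_hom_forall_eq_zero hR (ι := PUnit.{u + 1})
      ((Cardinal.mk_lt_aleph0).trans_le (Cardinal.IsRegular.aleph0_le Fact.out)) j (fun _ => t)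
      (fun _ => y) (fun _ => hy)
    exact ⟨k, f, hf ⟨⟩⟩

end PresentedOver

/-! ### Finite presentation of functors -/

/-- A set-valued functor on `ProdMod κ R` whose families of elements lift to a common object, and
whose elements come from presented modules, is generated by one element of a presented module. -/
lemma exists_generator (T : ProdMod κ R ⥤ Type u)
    (hprod : ∀ (ι : Type u) (M : ι → ProdMod κ R) (x : ∀ i, T.obj (M i)),
      ∃ (N : ProdMod κ R) (z : T.obj N) (π : ∀ i, N ⟶ M i), ∀ i, T.map (π i) z = x i)
    (hpres : ∀ (X : ProdMod κ R) (x : T.obj X),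
      ∃ (P : Presentation R) (f : P.prodMod κ ⟶ X) (y : T.obj (P.prodMod κ)), T.map f y = x) :
    ∃ (P : Presentation R) (y : T.obj (P.prodMod κ)), ∀ (X : ProdMod κ R) (x : T.obj X),
      ∃ f : P.prodMod κ ⟶ X, T.map f y = x := by
  -- `R` is small, so these pairs form a set and a single `z` lifts all of them.
  obtain ⟨N, z, π, hz⟩ := hprod (Σ P : Presentation R, T.obj (P.prodMod κ))
    (fun a => a.1.prodMod κ) (fun a => a.2)
  obtain ⟨P, g, y, hy⟩ := hpres N z
  refine ⟨P, y, fun X x => ?_⟩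
  obtain ⟨Q, f, w, rfl⟩ := hpres X x
  refine ⟨g ≫ π ⟨Q, w⟩ ≫ f, ?_⟩
  have := hz ⟨Q, w⟩
  simp_all

section

variable [Fact κ.IsRegular] {G : ProdMod κ R ⥤ AddCommGrpCat.{u}}

lemma additive_of_funCard (hG : funCard κ (ProdMod κ R) G) : G.Additive := by
  have := hG.2
  have : PreservesLimitsOfShape (Discrete WalkingPair) G :=
    preservesLimitsOfShape_of_equiv (Discrete.equivalence (Equiv.ulift.{u})) G
  have : PreservesLimitsOfShape (Discrete PEmpty.{1}) G :=
    preservesLimitsOfShape_of_equiv (Discrete.equivalence (Equiv.ulift.{u})) G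
  have : HasProducts.{u} (ProdMod κ R) := fun J => inferInstance
  have : HasFiniteProducts (ProdMod κ R) := hasFiniteProducts_of_hasProducts _
  have : HasZeroObject (ProdMod κ R) := hasZeroObject_of_hasTerminal_object
  have : G.PreservesZeroMorphisms := Functor.preservesZeroMorphisms_of_preserves_terminal_object
  exact Functor.additive_of_preserves_binary_products G

lemma bijective_map_pi (hG : funCard κ (ProdMod κ R) G) (ι : Type u) (M : ι → ProdMod κ R) :
    Function.Bijective (fun (x : G.obj (∏ᶜ M)) i => G.map (Pi.π M i) x) :=
  (preservesProducts_iff_bijective ι G).1 (hG.2 ι) _ _ (limit.isLimit (Discrete.functor M))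

lemma exists_presentation_rep [HasBinaryBiproducts R]
    (hR : HasSmallProducts κ R) (hG : funCard κ (ProdMod κ R) G)
    (X : ProdMod κ R) (x : G.obj X) :
    ∃ (P : Presentation R) (f : P.prodMod κ ⟶ X) (y : G.obj (P.prodMod κ)), G.map f y = x := by
  obtain ⟨hc⟩ := PresentedOver.nonempty_isColimit_cocone (X := X) hR
  have := PresentedOver.isCardinalFiltered (X := X) hR
  have := isFiltered_of_isCardinalFiltered (PresentedOver X) κ
  have := hG.1.preservesColimitOfShape (PresentedOver X)
  obtain ⟨j, y, hy⟩ := exists_rep_of_isColimit (isColimitOfPreserves G hc) x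
  exact ⟨j.1, j.2, y, hy⟩

/-- `(P, f)` is itself an index of the canonical diagram over `X`, so an element of `G` there that
dies in `G X` dies at a later index. -/
lemma exists_presentation_factor [HasBinaryBiproducts R]
    (hR : HasSmallProducts κ R) (hG : funCard κ (ProdMod κ R) G)
    {P : Presentation R} (y : G.obj (P.prodMod κ)) (X : ProdMod κ R) (f : P.prodMod κ ⟶ X)
    (hf : G.map f y = 0) :
    ∃ (Q : Presentation R) (g : P.prodMod κ ⟶ Q.prodMod κ) (h : Q.prodMod κ ⟶ X),
      g ≫ h = f ∧ G.map g y = 0 := by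
  obtain ⟨hc⟩ := PresentedOver.nonempty_isColimit_cocone (X := X) hR
  have := PresentedOver.isCardinalFiltered (X := X) hR
  have := isFiltered_of_isCardinalFiltered (PresentedOver X) κ
  have := hG.1.preservesColimitOfShape (PresentedOver X)
  obtain ⟨k, g, hg⟩ := exists_map_eq_zero_of_isColimit (isColimitOfPreserves G hc)
    (j := (⟨P, f⟩ : PresentedOver X)) y hf
  exact ⟨k.1, g.hom.left, k.2, Over.w g.hom, hg⟩

/-- The morphisms from an object that annihilate a given element of a functor. -/
def annihilators {C : Type*} [Category.{u} C] (G : C ⥤ AddCommGrpCat.{u}) {N : C} (y : G.obj N) :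
    C ⥤ Type u where
  obj X := {f : N ⟶ X // G.map f y = 0}
  map g := TypeCat.ofHom fun f => ⟨f.1 ≫ g, by
    rw [Functor.map_comp, ConcreteCategory.comp_apply, f.2, map_zero]⟩
  map_id X := by
    ext f
    exact Category.comp_id f.1
  map_comp g h := by
    ext f
    exact (Category.assoc f.1 g h).symm

/-- A functor in `funCard κ (ProdMod κ R)` is finitely presented by presented modules. -/
lemma exists_presentation_of_funCard [HasBinaryBiproducts R]
    (hR : HasSmallProducts κ R) (hG : funCard κ (ProdMod κ R) G) :
    ∃ (P Q : Presentation R) (y : G.obj (P.prodMod κ)) (g : P.prodMod κ ⟶ Q.prodMod κ),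
      (∀ (X : ProdMod κ R) (x : G.obj X), ∃ f : P.prodMod κ ⟶ X, G.map f y = x) ∧
      ∀ (X : ProdMod κ R) (f : P.prodMod κ ⟶ X), G.map f y = 0 ↔ ∃ h, g ≫ h = f := by
  obtain ⟨P, y, hy⟩ := exists_generator (G ⋙ forget AddCommGrpCat.{u})
    (fun ι M x => by
      obtain ⟨z, hz⟩ := (bijective_map_pi hG ι M).2 x
      exact ⟨_, z, Pi.π M, fun i => congrFun hz i⟩)
    (exists_presentation_rep hR hG)
  -- Now the kernel of `Hom(P, -) ⟶ G`: morphisms killing `y` assemble into one to the product that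
  -- kills `y`, as `G` preserves products.
  obtain ⟨Q, ⟨g, hg⟩, hQ⟩ := exists_generator (annihilators G y)
    (fun ι M f => by
      refine ⟨∏ᶜ M, ⟨Pi.lift fun i => (f i).1, (bijective_map_pi hG ι M).1 (funext fun i => ?_)⟩,
        Pi.π M, fun i => Subtype.ext (Pi.lift_π _ _)⟩
      dsimp
      rw [← ConcreteCategory.comp_apply, ← Functor.map_comp, Pi.lift_π, (f i).2, map_zero])
    (fun X f => by
      obtain ⟨Q, g, h, hgh, hg⟩ := exists_presentation_factor hR hG y X f.1 f.2
      exact ⟨Q, h, ⟨g, hg⟩, Subtype.ext hgh⟩)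
  refine ⟨P, Q, y, g, hy, fun X f => ⟨fun hf => ?_, ?_⟩⟩
  · obtain ⟨h, hh⟩ := hQ X ⟨f, hf⟩
    exact ⟨h, congrArg Subtype.val hh⟩
  · rintro ⟨h, rfl⟩
    rw [Functor.map_comp, ConcreteCategory.comp_apply, hg, map_zero]

end

/-! ### From a presentation to a pp-pair -/

section

variable {n m l k : R} (A : n ⟶ m) (B : l ⟶ k) (e : l ⟶ n)

/-- The pp-formula `A x = 0`. -/
def kerFormula : PPFormula R n := ⟨m, m, A, 0⟩

lemma mem_sol_kerFormula {M : LeftMod R} {x : M.obj.obj n} :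
    x ∈ (kerFormula A).sol M ↔ M.obj.map A x = 0 := by
  constructor
  · rintro ⟨y, hy⟩
    refine hy.trans ?_
    rw [show (kerFormula A).B = 0 from rfl, Functor.map_zero]
    rfl
  · intro h
    exact ⟨0, h.trans (map_zero _).symm⟩

variable [HasBinaryBiproducts R]

/-- The pp-formula expressing that `x = e y` for some `y` with `B y = 0`. -/
def imageFormula : PPFormula R n := ⟨n ⊞ k, l, biprod.inl, biprod.lift e B⟩

lemma mem_sol_imageFormula {M : LeftMod R} {x : M.obj.obj n} :
    x ∈ (imageFormula B e).sol M ↔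
      ∃ y : M.obj.obj l, M.obj.map e y = x ∧ M.obj.map B y = 0 := by
  constructor
  · rintro ⟨(y : M.obj.obj l), hy⟩
    -- One equation in degree `n ⊞ k` encodes both `x = e y` and `0 = B y`; the projections separate
    -- them.
    have hy : M.obj.map biprod.inl x = M.obj.map (biprod.lift e B) y := hy
    refine ⟨y, ?_, ?_⟩
    · have := congrArg (M.obj.map biprod.fst) hy
      rw [← ConcreteCategory.comp_apply, ← ConcreteCategory.comp_apply, ← Functor.map_comp,
        ← Functor.map_comp, biprod.lift_fst, biprod.inl_fst, CategoryTheory.Functor.map_id] at this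
      exact this.symm
    · have := congrArg (M.obj.map biprod.snd) hy
      rw [← ConcreteCategory.comp_apply, ← ConcreteCategory.comp_apply, ← Functor.map_comp,
        ← Functor.map_comp, biprod.lift_snd, biprod.inl_snd, Functor.map_zero] at this
      exact this.symm
  · rintro ⟨y, rfl, hy⟩
    refine ⟨y, ?_⟩
    change M.obj.map biprod.inl (M.obj.map e y) = M.obj.map (biprod.lift e B) y
    rw [biprod.lift_eq, Functor.map_add, Functor.map_comp, Functor.map_comp]
    change _ = M.obj.map biprod.inl (M.obj.map e y) + M.obj.map biprod.inr (M.obj.map B y)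
    rw [hy, map_zero, add_zero]

/-- The pp-pair of the formulas `A x = 0` and `x = e y` with `B y = 0`, where `A e` factors
through `B`. -/
def cokerPair (h : k ⟶ m) (w : B ≫ h = e ≫ A) : PPPair R n where
  φ := kerFormula A
  ψ := imageFormula B e
  le M x hx := by
    obtain ⟨y, rfl, hy⟩ := (mem_sol_imageFormula B e).1 hx
    rw [mem_sol_kerFormula, ← ConcreteCategory.comp_apply, ← Functor.map_comp, ← w,
      Functor.map_comp, ConcreteCategory.comp_apply, hy, map_zero]

end

section

variable {P : Presentation R} {X : ProdMod κ R}

/-- The morphism from a presented module to `X` given by a solution of the relation in `X`. -/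
def prodDesc (x : X.obj.obj.obj P.n) (hx : x ∈ (kerFormula P.A).sol X.obj) :
    P.prodMod κ ⟶ X :=
  ObjectProperty.homMk (P.desc x ((mem_sol_kerFormula P.A).1 hx))

lemma prodDesc_gen (x : X.obj.obj.obj P.n) (hx : x ∈ (kerFormula P.A).sol X.obj) :
    (prodDesc (κ := κ) x hx).hom.hom.app P.n P.gen = x :=
  P.desc_gen x ((mem_sol_kerFormula P.A).1 hx)

lemma prodMod_hom_ext {f g : P.prodMod κ ⟶ X}
    (h : f.hom.hom.app P.n P.gen = g.hom.hom.app P.n P.gen) : f = g := by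
  ext : 1
  exact Presentation.hom_ext h

end

/-- Every functor in `funCard κ (ProdMod κ R)` is the restriction of that of a pp-pair. -/
lemma exists_ppPair_of_funCard [Fact κ.IsRegular] [HasBinaryBiproducts R]
    (hR : HasSmallProducts κ R) {G : ProdMod κ R ⥤ AddCommGrpCat.{u}}
    (hG : funCard κ (ProdMod κ R) G) :
    ∃ (n : R) (p : PPPair R n), Nonempty (G ≅ restrict κ p.functor) := by
  obtain ⟨P, Q, y, g, hgen, hker⟩ := exists_presentation_of_funCard hR hG
  have := additive_of_funCard hG
  -- `g` is determined by the image of the generator, the class of `e`; that this image satisfies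
  -- the relation of `P` provides `h`.
  obtain ⟨e, he⟩ := Q.cls_surjective (g.hom.hom.app P.n P.gen)
  obtain ⟨h, hh⟩ := Q.cls_eq_zero_iff.1 (show Q.cls (e ≫ P.A) = 0 by
    rw [← Presentation.map_cls, he]
    exact P.map_A_app_gen g.hom)
  let p : PPPair R P.n := cokerPair P.A Q.A e h hh
  have hψ (X : ProdMod κ R) (x : X.obj.obj.obj P.n) (hx : x ∈ (kerFormula P.A).sol X.obj) :
      G.map (prodDesc x hx) y = 0 ↔ x ∈ (imageFormula Q.A e).sol X.obj := by
    rw [hker, mem_sol_imageFormula]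
    have key (f : Q.prodMod κ ⟶ X) : (g ≫ f).hom.hom.app P.n P.gen =
        X.obj.obj.map e (f.hom.hom.app Q.n Q.gen) :=
      (congrArg (f.hom.hom.app P.n) he.symm).trans (Presentation.app_cls f.hom e)
    constructor
    · rintro ⟨f, hf⟩
      refine ⟨f.hom.hom.app Q.n Q.gen, ?_, Q.map_A_app_gen f.hom⟩
      rw [← key, hf, prodDesc_gen]
    · rintro ⟨z, hz, hz'⟩
      refine ⟨ObjectProperty.homMk (Q.desc z hz'), prodMod_hom_ext ?_⟩
      rw [key, prodDesc_gen, ← hz]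
      exact congrArg _ (Q.desc_gen z hz')
  -- This is `Hom(P, X) ⟶ G X`, evaluation at `y`; it is additive because `G` is.
  let α (X : ProdMod κ R) : (kerFormula P.A).sol X.obj →+ G.obj X :=
    AddMonoidHom.mk' (fun x => G.map (prodDesc x.1 x.2) y) (fun x x' => by
      rw [show prodDesc (x + x').1 (x + x').2 = prodDesc x.1 x.2 + prodDesc x'.1 x'.2 from
        prodMod_hom_ext ((prodDesc_gen _ _).trans
          (congrArg₂ (· + ·) (prodDesc_gen x.1 x.2) (prodDesc_gen x'.1 x'.2)).symm)]
      rw [Functor.map_add]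
      rfl)
  let β (X : ProdMod κ R) : (restrict κ p.functor).obj X ⟶ G.obj X :=
    AddCommGrpCat.ofHom (QuotientAddGroup.lift _ (α X) (fun x hx =>
      (hψ X x.1 x.2).2 (AddSubgroup.mem_addSubgroupOf.1 hx)))
  have hβ (X : ProdMod κ R) (x : X.obj.obj.obj P.n) (hx : x ∈ (kerFormula P.A).sol X.obj) :
      β X (p.cls x hx) = G.map (prodDesc x hx) y := rfl
  have (X : ProdMod κ R) : IsIso (β X) := by
    rw [ConcreteCategory.isIso_iff_bijective]
    constructor
    · rw [injective_iff_map_eq_zero]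
      intro z hz
      obtain ⟨x, hx, rfl⟩ := p.cls_surjective z
      exact (p.cls_eq_zero_iff x hx).2 ((hψ X x hx).1 hz)
    · intro z
      obtain ⟨f, rfl⟩ := hgen X z
      refine ⟨p.cls (f.hom.hom.app P.n P.gen)
        ((mem_sol_kerFormula P.A).2 (P.map_A_app_gen f.hom)), ?_⟩
      rw [hβ]
      congr 3
      exact prodMod_hom_ext (prodDesc_gen _ _)
  refine ⟨P.n, p, ⟨(NatIso.ofComponents (fun X => asIso (β X)) fun {X Y} f => ?_).symm⟩⟩
  ext z
  obtain ⟨x, hx, rfl⟩ := p.cls_surjective z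
  have : prodDesc x hx ≫ f = prodDesc (f.hom.hom.app P.n x) ((kerFormula P.A).sol_map f.hom hx) :=
    prodMod_hom_ext ((congrArg (f.hom.hom.app P.n) (prodDesc_gen x hx)).trans
      (prodDesc_gen _ _).symm)
  change β Y (p.cls _ ((kerFormula P.A).sol_map f.hom hx)) = G.map f (β X (p.cls x hx))
  refine (hβ Y _ _).trans (Eq.trans ?_ (congrArg (G.map f) (hβ X x hx)).symm)
  rw [← ConcreteCategory.comp_apply, ← Functor.map_comp, this]

end LambdaModules

end

theorem mainTheorem2 (κ : Cardinal.{u}) [Fact κ.IsRegular]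
    (R : Type u) [SmallCategory R] [Preadditive R] [HasFiniteBiproducts R]
    (hR : LambdaModules.HasSmallProducts κ R) :
    (∀ G : LambdaModules.ProdMod κ R ⥤ AddCommGrpCat.{u},
      LambdaModules.funCard κ (LambdaModules.ProdMod κ R) G ↔
        ∃ F : LambdaModules.LeftMod R ⥤ AddCommGrpCat.{u},
          LambdaModules.funFin (LambdaModules.LeftMod R) F ∧ G = LambdaModules.restrict κ F) ∧
    (∀ G : LambdaModules.ProdMod κ R ⥤ AddCommGrpCat.{u},
      LambdaModules.funCard κ (LambdaModules.ProdMod κ R) G ↔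
        ∃ (n : R) (p : LambdaModules.PPPair R n),
          Nonempty (G ≅ LambdaModules.restrict κ p.functor)) := by
  have := HasBinaryBiproducts.of_hasBinaryProducts (C := R)
  refine ⟨fun G => ⟨fun hG => ?_, ?_⟩, fun G => ⟨?_, ?_⟩⟩
  · obtain ⟨n, p, ⟨i⟩⟩ := LambdaModules.exists_ppPair_of_funCard hR hG
    -- Equality is required here, so the pp-pair functor is replaced by an isomorphic one that
    -- agrees with `G`.
    obtain ⟨F, ⟨j⟩, hF⟩ := LambdaModules.exists_iso_restrict_eq κ i.symm
    have : Fact (Cardinal.aleph0.{u}).IsRegular := Cardinal.fact_isRegular_aleph0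
    exact ⟨F, LambdaModules.funCard_of_iso _ j p.funFin_functor, hF⟩
  · rintro ⟨F, hF, rfl⟩
    exact LambdaModules.funCard_restrict κ hF
  · exact LambdaModules.exists_ppPair_of_funCard hR
  · rintro ⟨n, p, ⟨i⟩⟩
    exact LambdaModules.funCard_of_iso κ i.symm (LambdaModules.funCard_restrict κ p.funFin_functor)
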